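/- **Theorem 4.4.** For a finite group $G$ (written multiplicatively), let $\mathcal B(G)$ be the monoid of product-one sequences over $G$, i.e. of all finite unordered sequences of elements of $G$ (repetition allowed) whose terms can be ordered so that their product is $1_G$; the operation is concatenation and the empty sequence is the identity element. Let $\mathsf D(G)$, the large Davenport constant, be the maximal number of terms of an atom (irreducible element) of $\mathcal B(G)$. For $S \in \mathcal B(G)$, let $\mathsf L(S)$ be the set of all $k \in \mathbb N$ such that $S$ is a product of $k$ atoms of $\mathcal B(G)$, with $\mathsf L(S) = \{0\}$ if $S$ is the empty sequence, and let $\mathcal L(G) = \{\mathsf L(S) : S \in \mathcal B(G)\}$ be the system of sets of lengths. Write $C_m$ for a cyclic group of order $m$ and $D_{2n}$ for the dihedral group of order $2n$. Let $G$ and $G^*$ be finite groups and let $n \ge 3$ be an odd integer. 1. If $|G|$ is odd and $|G| \ge 3$, then $\{2, \mathsf D(G)\} \in \mathcal L(G)$ if and only if $G \cong C_{\mathsf D(G)}$. 2. If $|G|$ is odd and $|G| \ge 3$, and $G^*$ is cyclic with $\mathcal L(G^*) = \mathcal L(G)$, then $G^* \cong G$. 3. We have $\{2, \mathsf D(D_{2n})\}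 \in \mathcal L(D_{2n})$, and there is an $L \in \mathcal L(D_{2n})$ with $\{2, \mathsf D(D_{2n})\} \subsetneq L$. 4. If $G^*$ is abelian, then $\mathcal L(G^*) \ne \mathcal L(D_{2n})$. -/

import Mathlib

/-- The monoid of product-one sequences over `G`: a sequence is a finite multiset of elements
of `G` (an element of the free abelian monoid with basis `G`, written additively), and it is a
product-one sequence if its terms can be ordered in such a way that their product is `1`. -/
def productOne (G : Type*) [Group G] : AddSubmonoid (Multiset G) where
  carrier := {S | ∃ l : List G, (l : Multiset G) = S ∧ l.prod = 1}
  zero_mem' := ⟨[], rfl, rfl⟩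
  add_mem' := by
    rintro S T ⟨l, rfl, hl⟩ ⟨m, rfl, hm⟩
    exact ⟨l ++ m, by simp, by simp [hl, hm]⟩

/-- The set of lengths of an element `a` of a commutative monoid (written additively): it is
`{0}` if `a` is invertible, and otherwise it consists of all `k ≥ 1` such that `a` is a sum of
`k` atoms. (Sums of a positive number of atoms are never invertible.) -/
def setOfLengths {H : Type*} [AddCommMonoid H] (a : H) : Set ℕ :=
  {k | (k = 0 ∧ IsAddUnit a) ∨
    (0 < k ∧ ∃ s : Multiset H, (∀ u ∈ s, AddIrreducible u) ∧ s.card = k ∧ s.sum = a)}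

/-- The system of sets of lengths of the monoid of product-one sequences over `G`. -/
def systemOfLengths (G : Type*) [Group G] : Set (Set ℕ) :=
  {L | ∃ S : productOne G, setOfLengths S = L}

/-- The set of all lengths (numbers of terms) of atoms of the monoid of product-one sequences. -/
def atomLengths (G : Type*) [Group G] : Set ℕ :=
  {m | ∃ S : productOne G, AddIrreducible S ∧ (S : Multiset G).card = m}

/-- The large Davenport constant of a finite group `G`: the maximal number of terms of an atom of
the monoid of product-one sequences. For finite `G` the supremum is a maximum, see
`isGreatest_davenport`. -/
noncomputable def davenport (G : Type*) [Group G] : ℕ :=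
  sSup (atomLengths G)

theorem productOne_isAddUnit_iff {G : Type*} [Group G] (S : productOne G) :
    IsAddUnit S ↔ (S : Multiset G) = 0 := by
  constructor
  · intro h
    obtain ⟨T, hT⟩ := h.exists_neg
    have h1 : (S : Multiset G) + T = 0 := by
      have := congrArg (fun x : productOne G => (x : Multiset G)) hT
      simpa using this
    exact (add_eq_zero.mp h1).1
  · intro h
    have : S = 0 := Subtype.ext h
    rw [this]
    exact isAddUnit_zero

theorem atomLengths_le_card {G : Type*} [Group G] [Finite G] {m : ℕ} (hm : m ∈ atomLengths G) :
    m ≤ Nat.card G := by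
  obtain ⟨S, hS, rfl⟩ := hm
  obtain ⟨l, hl, hprod⟩ := S.2
  by_contra! hlt
  have hlen : Nat.card G < l.length := by
    rw [← hl] at hlt
    simpa using hlt
  have : Fintype G := Fintype.ofFinite G
  obtain ⟨x, y, hxy, hf⟩ := Fintype.exists_ne_map_eq_of_card_lt
    (fun i : Fin l.length => (l.take i).prod) (by simpa [Nat.card_eq_fintype_card] using hlen)
  wlog hlt' : x < y generalizing x y
  · exact this y x hxy.symm hf.symm (lt_of_le_of_ne (not_lt.mp hlt') hxy.symm)
  obtain ⟨i, hi⟩ := x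
  obtain ⟨j, hj⟩ := y
  simp only [Fin.mk_lt_mk] at hlt'
  simp only at hf
  set A := l.take i with hA
  set B := (l.take j).drop i with hB
  set C := l.drop j with hC
  have hAB : A ++ B = l.take j := by
    have := List.take_append_drop i (l.take j)
    rwa [List.take_take, min_eq_left hlt'.le] at this
  have hABC : A ++ B ++ C = l := by rw [hAB, List.take_append_drop]
  have hB1 : B.prod = 1 := by
    rw [← hAB, List.prod_append] at hf
    exact (mul_eq_left.mp hf.symm)
  have hAC : (A ++ C).prod = 1 := by
    rw [← hABC, List.prod_append, List.prod_append, hB1, mul_one] at hprod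
    rw [List.prod_append, hprod]
  have hsum : S = (⟨(B : Multiset G), B, rfl, hB1⟩ : productOne G) +
      ⟨((A ++ C : List G) : Multiset G), A ++ C, rfl, hAC⟩ := by
    apply Subtype.ext
    rw [← hl, ← hABC]
    simp only [AddSubmonoid.coe_add, ← Multiset.coe_add]
    abel
  rcases hS.2 hsum with h | h
  · rw [productOne_isAddUnit_iff] at h
    have h0 : B.length = 0 := by simpa using congrArg Multiset.card h
    simp [hB] at h0
    omega
  · rw [productOne_isAddUnit_iff] at h
    have h0 : (A ++ C).length = 0 := by simpa using congrArg Multiset.card h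
    simp [hC] at h0
    omega

/-- For finite `G`, the supremum that defines the Davenport constant is a maximum. -/
theorem isGreatest_davenport (G : Type*) [Group G] [Finite G] :
    IsGreatest (atomLengths G) (davenport G) := by
  have hb : BddAbove (atomLengths G) := ⟨Nat.card G, fun _ hm => atomLengths_le_card hm⟩
  have hne : (atomLengths G).Nonempty := by
    refine ⟨1, ⟨({1} : Multiset G), [1], rfl, by simp⟩, ⟨?_, ?_⟩, by simp⟩
    · rw [productOne_isAddUnit_iff]
      simp
    · intro a b hab
      have h1 : (a : Multiset G).card + (b : Multiset G).card = 1 := by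
        have := congrArg (fun x : productOne G => (x : Multiset G).card) hab
        simpa using this.symm
      rw [productOne_isAddUnit_iff, productOne_isAddUnit_iff, ← Multiset.card_eq_zero,
        ← Multiset.card_eq_zero]
      omega
  exact ⟨Nat.sSup_mem hne hb, fun m hm => le_csSup hb hm⟩

/-
If `2` and `D(G)` both lie in `L(S)`, then counting terms shows that `S = U + V` for atoms `U`, `V`
with `D(G)` terms each, and that `S` is also a product of `D(G)` pairs `x, x⁻¹`. For `|G|` odd no
nontrivial element is its own inverse, so `S = Y + Y⁻¹` for a sequence `Y` with no two mutually
inverse terms; if `L(S) = {2, D(G)}`, replacing parts of `Y` by their inverses shows that `Y` is a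
minimal product-one sequence with central, and finally equal, terms, whence `G` is cyclic of order
`D(G)`. The same replacement in an abelian group leaves only a cyclic or an elementary `2`-group,
and for these `L = {2, D(G)}` is the only member of the system containing `{2, D(G)}`. A dihedral
group `D_{2n}`, `n` odd, has two such members: `{2, 2n}`, from the square of
`(sr 0)^n (sr 1)^n`, and a larger one, from the atom `(r 1)^{2n-2} (sr 0)^2`, which contains the
shorter atom `(r 1)^n`.
-/

section Multiset

variable {α : Type*}

theorem exists_le_add_le_of_le_add {Z A B : Multiset α} (h : Z ≤ A + B) :
    ∃ S ≤ A, ∃ T ≤ B, S + T = Z := by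
  classical
  refine ⟨Z ∩ A, Multiset.inter_le_right, Z - A, tsub_le_iff_left.2 h, ?_⟩
  rw [add_comm, Multiset.sub_add_inter]

theorem exists_eq_replicate_add_replicate_of_add_eq {A B : Multiset α} {p q : ℕ} {x y : α}
    (h : A + B = Multiset.replicate p x + Multiset.replicate q y) :
    ∃ i i' j j', i + i' = p ∧ j + j' = q ∧
      A = Multiset.replicate i x + Multiset.replicate j y ∧
      B = Multiset.replicate i' x + Multiset.replicate j' y := by
  obtain ⟨S, hS, T, hT, rfl⟩ := exists_le_add_le_of_le_add (h ▸ Multiset.le_add_right A B)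
  obtain ⟨i, hi, rfl⟩ := Multiset.le_replicate_iff.1 hS
  obtain ⟨j, hj, rfl⟩ := Multiset.le_replicate_iff.1 hT
  obtain ⟨i', rfl⟩ := Nat.exists_eq_add_of_le hi
  obtain ⟨j', rfl⟩ := Nat.exists_eq_add_of_le hj
  refine ⟨i, i', j, j', rfl, rfl, rfl, ?_⟩
  rwa [Multiset.replicate_add, Multiset.replicate_add, add_add_add_comm, add_right_inj] at h

theorem card_sum_eq_card_mul {s : Multiset (Multiset α)} {c : ℕ} (hs : ∀ u ∈ s, u.card = c) :
    s.sum.card = s.card * c := by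
  rw [← Multiset.join, Multiset.card_join, Multiset.map_congr rfl hs, Multiset.map_const',
    Multiset.sum_replicate, smul_eq_mul]

theorem card_mul_le_card_sum {s : Multiset (Multiset α)} {c : ℕ} (hs : ∀ u ∈ s, c ≤ u.card) :
    s.card * c ≤ s.sum.card := by
  rw [← Multiset.join, Multiset.card_join, ← smul_eq_mul, ← Multiset.card_map Multiset.card]
  exact Multiset.card_nsmul_le_sum fun k hk => by
    obtain ⟨u, hu, rfl⟩ := Multiset.mem_map.1 hk
    exact hs u hu

theorem card_eq_of_card_sum_le {s : Multiset (Multiset α)} {c : ℕ} (hs : ∀ u ∈ s, c ≤ u.card)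
    (h : s.sum.card ≤ s.card * c) {u : Multiset α} (hu : u ∈ s) : u.card = c := by
  obtain ⟨t, rfl⟩ := Multiset.exists_cons_of_mem hu
  have ht := card_mul_le_card_sum fun v hv => hs v (Multiset.mem_cons_of_mem hv)
  rw [Multiset.sum_cons, Multiset.card_add, Multiset.card_cons, add_one_mul] at h
  exact le_antisymm (by omega) (hs u hu)

end Multiset

section ProductOne

variable {G : Type*} [Group G]

theorem cons_mem_productOne_iff {a : G} {T : Multiset G} :
    a ::ₘ T ∈ productOne G ↔ ∃ l : List G, (l : Multiset G) = T ∧ a * l.prod = 1 := by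
  constructor
  · rintro ⟨l, hl, hp⟩
    have ha : a ∈ l := by
      rw [← Multiset.mem_coe, hl]
      exact Multiset.mem_cons_self a T
    obtain ⟨l₁, l₂, rfl⟩ := List.append_of_mem ha
    refine ⟨l₂ ++ l₁, (Multiset.cons_inj_right a).1 ?_, ?_⟩
    · rw [← hl, Multiset.cons_coe, Multiset.coe_eq_coe]
      exact List.perm_append_comm (l₁ := a :: l₂) (l₂ := l₁)
    · rw [List.prod_append, List.prod_cons] at hp
      rw [List.prod_append, ← mul_assoc]
      exact mul_eq_one_comm.1 hp
  · rintro ⟨l, rfl, hp⟩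
    exact ⟨a :: l, by simp, by simpa using hp⟩

theorem one_cons_mem_productOne_iff {T : Multiset G} :
    1 ::ₘ T ∈ productOne G ↔ T ∈ productOne G := by
  simp only [cons_mem_productOne_iff, one_mul]
  rfl

theorem replicate_mem_productOne_iff {k : ℕ} {x : G} :
    Multiset.replicate k x ∈ productOne G ↔ x ^ k = 1 := by
  refine ⟨?_, fun h => ⟨List.replicate k x, rfl, by simpa using h⟩⟩
  rintro ⟨l, hl, hp⟩
  rw [← Multiset.coe_replicate, Multiset.coe_eq_coe, List.perm_replicate] at hl
  rwa [hl, List.prod_replicate] at hp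

theorem pair_mem_productOne_iff {a b : G} : {a, b} ∈ productOne G ↔ a * b = 1 := by
  rw [Multiset.insert_eq_cons, cons_mem_productOne_iff]
  simp only [Multiset.coe_eq_singleton, exists_eq_left, List.prod_singleton]

theorem map_inv_mem_productOne {S : Multiset G} (hS : S ∈ productOne G) :
    S.map (·⁻¹) ∈ productOne G := by
  obtain ⟨l, rfl, hl⟩ := hS
  exact ⟨(l.map (·⁻¹)).reverse, by simp, by rw [← List.prod_inv_reverse, hl, inv_one]⟩

theorem nsmul_coe_mem_productOne {l : List G} {k : ℕ} (h : l.prod ^ k = 1) :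
    k • (l : Multiset G) ∈ productOne G := by
  refine ⟨(List.replicate k l).flatten, ?_, by simpa using h⟩
  clear h
  induction k with
  | zero => simp
  | succ k ih =>
    rw [List.replicate_succ, List.flatten_cons, ← Multiset.coe_add, ih, succ_nsmul']

theorem prod_map_eq_one_of_mem_productOne {M : Type*} [CommMonoid M] (f : G →* M) {S : Multiset G}
    (hS : S ∈ productOne G) : (S.map f).prod = 1 := by
  obtain ⟨l, rfl, hl⟩ := hS
  rw [Multiset.map_coe, Multiset.prod_coe, ← map_list_prod, hl, map_one]

theorem mem_productOne_iff_prod_eq_one {G : Type*} [CommGroup G] {S : Multiset G} :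
    S ∈ productOne G ↔ S.prod = 1 := by
  constructor
  · rintro ⟨l, rfl, hl⟩
    simpa using hl
  · intro h
    exact ⟨S.toList, by simp, by simpa using h⟩

end ProductOne

/-- The underlying multisets of the atoms of `productOne G`: nonempty product-one sequences that
are not the concatenation of two nonempty product-one sequences. Stated on multisets rather than
on the subtype so that subsequences need no membership proofs. -/
structure IsProductOneAtom {G : Type*} [Group G] (S : Multiset G) : Prop where
  mem_productOne : S ∈ productOne G
  ne_zero : S ≠ 0
  eq_zero_or_eq_zero : ∀ ⦃A⦄, A ∈ productOne G → ∀ ⦃B⦄, B ∈ productOne G → A + B = S →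
    A = 0 ∨ B = 0

/-- A product-one sequence that is minimal for inclusion among the nonempty ones (in the
literature: a minimal product-one sequence). In a nonabelian group an atom need not be minimal,
because the terms left over by a product-one subsequence need not be product-one. -/
def IsMinimalProductOne {G : Type*} [Group G] (S : Multiset G) : Prop :=
  Minimal (fun T => T ∈ productOne G ∧ T ≠ 0) S

/-- The set of lengths of a sequence, in terms of factorizations into multisets; for product-one
sequences it is `setOfLengths`, see `setOfLengths_eq_lengths`. -/
def lengths {G : Type*} [Group G] (S : Multiset G) : Set ℕ :=
  {k | ∃ s : Multiset (Multiset G), (∀ u ∈ s, IsProductOneAtom u) ∧ s.card = k ∧ s.sum = S}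

section Atom

variable {G : Type*} [Group G]

theorem addIrreducible_iff_isProductOneAtom (S : productOne G) :
    AddIrreducible S ↔ IsProductOneAtom (S : Multiset G) := by
  simp only [addIrreducible_iff, productOne_isAddUnit_iff]
  constructor
  · rintro ⟨h0, h⟩
    exact ⟨S.2, h0, fun A hA B hB hAB => h (a := ⟨A, hA⟩) (b := ⟨B, hB⟩) (Subtype.ext hAB.symm)⟩
  · rintro ⟨-, h0, h⟩
    exact ⟨h0, fun A B hAB => h A.2 B.2 (congrArg Subtype.val hAB).symm⟩

theorem mem_atomLengths_iff {m : ℕ} :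
    m ∈ atomLengths G ↔ ∃ S : Multiset G, IsProductOneAtom S ∧ S.card = m := by
  constructor
  · rintro ⟨S, hS, hm⟩
    exact ⟨S, (addIrreducible_iff_isProductOneAtom S).1 hS, hm⟩
  · rintro ⟨S, hS, hm⟩
    exact ⟨⟨S, hS.1⟩, (addIrreducible_iff_isProductOneAtom ⟨S, hS.1⟩).2 hS, hm⟩

theorem davenport_le_card [Finite G] : davenport G ≤ Nat.card G :=
  atomLengths_le_card (isGreatest_davenport G).1

theorem exists_isProductOneAtom_card_eq_davenport (G : Type*) [Group G] [Finite G] :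
    ∃ S : Multiset G, IsProductOneAtom S ∧ S.card = davenport G :=
  mem_atomLengths_iff.1 (isGreatest_davenport G).1

theorem two_le_card_of_mem_productOne {S : Multiset G} (hS : S ∈ productOne G) (h0 : S ≠ 0)
    (h1 : (1 : G) ∉ S) : 2 ≤ S.card := by
  by_contra! h
  obtain ⟨a, rfl⟩ := Multiset.card_eq_one.1
    (show S.card = 1 by have := Multiset.card_pos.2 h0; omega)
  rw [← Multiset.replicate_one, replicate_mem_productOne_iff, pow_one] at hS
  exact h1 (hS ▸ Multiset.mem_singleton_self a)

theorem isProductOneAtom_pair {x : G} (hx : x ≠ 1) : IsProductOneAtom {x, x⁻¹} where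
  mem_productOne := pair_mem_productOne_iff.2 (mul_inv_cancel x)
  ne_zero := by simp
  eq_zero_or_eq_zero A hA B hB hAB := by
    by_contra! h
    have h1 : (1 : G) ∉ A + B := by simpa [hAB, eq_comm] using hx
    rw [Multiset.mem_add, not_or] at h1
    have hA2 := two_le_card_of_mem_productOne hA h.1 h1.1
    have hB2 := two_le_card_of_mem_productOne hB h.2 h1.2
    have hc := congrArg Multiset.card hAB
    rw [Multiset.card_add, Multiset.card_pair] at hc
    omega

theorem exists_eq_pair_of_card_eq_two {S : Multiset G} (hS : S ∈ productOne G)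
    (hc : S.card = 2) : ∃ x : G, S = {x, x⁻¹} := by
  obtain ⟨x, y, rfl⟩ := Multiset.card_eq_two.1 hc
  exact ⟨x, by rw [eq_inv_of_mul_eq_one_right (pair_mem_productOne_iff.1 hS)]⟩

namespace IsProductOneAtom

variable {U : Multiset G}

theorem card_le_davenport [Finite G] (hU : IsProductOneAtom U) : U.card ≤ davenport G :=
  (isGreatest_davenport G).2 (mem_atomLengths_iff.2 ⟨U, hU, rfl⟩)

theorem map_inv (hU : IsProductOneAtom U) : IsProductOneAtom (U.map (·⁻¹)) where
  mem_productOne := map_inv_mem_productOne hU.mem_productOne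
  ne_zero := by simpa using hU.ne_zero
  eq_zero_or_eq_zero A hA B hB hAB := by
    simpa using hU.eq_zero_or_eq_zero (map_inv_mem_productOne hA) (map_inv_mem_productOne hB)
      (by rw [← Multiset.map_add, hAB]; simp)

theorem eq_singleton_one (hU : IsProductOneAtom U) (h1 : (1 : G) ∈ U) : U = {1} := by
  obtain ⟨T, rfl⟩ := Multiset.exists_cons_of_mem h1
  have hone : ({1} : Multiset G) ∈ productOne G := one_cons_mem_productOne_iff.2 (zero_mem _)
  have hT : T ∈ productOne G := one_cons_mem_productOne_iff.1 hU.mem_productOne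
  have hT0 : T = 0 := (hU.eq_zero_or_eq_zero hone hT (Multiset.singleton_add 1 T)).resolve_left
    (Multiset.singleton_ne_zero 1)
  rw [hT0, Multiset.cons_zero]

theorem one_notMem (hU : IsProductOneAtom U) (hc : 2 ≤ U.card) : (1 : G) ∉ U := fun h => by
  rw [hU.eq_singleton_one h, Multiset.card_singleton] at hc
  omega

theorem two_le_card (hU : IsProductOneAtom U) (h1 : (1 : G) ∉ U) : 2 ≤ U.card :=
  two_le_card_of_mem_productOne hU.mem_productOne hU.ne_zero h1

end IsProductOneAtom

theorem IsMinimalProductOne.isProductOneAtom {S : Multiset G} (hS : IsMinimalProductOne S) :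
    IsProductOneAtom S where
  mem_productOne := hS.prop.1
  ne_zero := hS.prop.2
  eq_zero_or_eq_zero A hA B _ hAB := by
    refine or_iff_not_imp_left.2 fun hA0 => ?_
    have hAS : A = A + B := by
      rw [hAB]
      exact hS.eq_of_le ⟨hA, hA0⟩ (hAB ▸ Multiset.le_add_right A B)
    exact left_eq_add.1 hAS

theorem exists_isMinimalProductOne_le {S : Multiset G} (hS : S ∈ productOne G) (h0 : S ≠ 0) :
    ∃ T ≤ S, IsMinimalProductOne T :=
  exists_minimal_le_of_wellFoundedLT (fun T => T ∈ productOne G ∧ T ≠ 0) S ⟨hS, h0⟩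

end Atom

section Lengths

variable {G : Type*} [Group G]

theorem mem_productOne_of_mem_lengths {S : Multiset G} {k : ℕ} (h : k ∈ lengths S) :
    S ∈ productOne G := by
  obtain ⟨s, hs, -, rfl⟩ := h
  exact AddSubmonoid.multiset_sum_mem _ s fun u hu => (hs u hu).mem_productOne

theorem setOfLengths_eq_lengths (S : productOne G) :
    setOfLengths S = lengths (S : Multiset G) := by
  ext k
  constructor
  · rintro (⟨rfl, h⟩ | ⟨-, s, hs, hk, hsum⟩)
    · exact ⟨0, by simp, rfl, ((productOne_isAddUnit_iff S).1 h).symm⟩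
    · refine ⟨s.map Subtype.val, fun u hu => ?_, by simpa using hk, ?_⟩
      · obtain ⟨v, hv, rfl⟩ := Multiset.mem_map.1 hu
        exact (addIrreducible_iff_isProductOneAtom v).1 (hs v hv)
      · rw [← AddSubmonoid.coe_multiset_sum, hsum]
  · rintro ⟨s, hs, hk, hsum⟩
    rcases Nat.eq_zero_or_pos k with rfl | hpos
    · rw [Multiset.card_eq_zero.1 hk] at hsum
      exact Or.inl ⟨rfl, (productOne_isAddUnit_iff S).2 hsum.symm⟩
    · lift s to Multiset (productOne G) using fun u hu => (hs u hu).mem_productOne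
      refine Or.inr ⟨hpos, s, fun u hu => ?_, by simpa using hk, Subtype.ext ?_⟩
      · exact (addIrreducible_iff_isProductOneAtom u).2 (hs u (Multiset.mem_map_of_mem _ hu))
      · rw [AddSubmonoid.coe_multiset_sum, hsum]

theorem lengths_mem_systemOfLengths {S : Multiset G} (hS : S ∈ productOne G) :
    lengths S ∈ systemOfLengths G :=
  ⟨⟨S, hS⟩, setOfLengths_eq_lengths _⟩

theorem exists_lengths_eq_of_mem_systemOfLengths {L : Set ℕ} (hL : L ∈ systemOfLengths G) :
    ∃ S : Multiset G, lengths S = L := by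
  obtain ⟨S, hS⟩ := hL
  exact ⟨S, by rw [← setOfLengths_eq_lengths, hS]⟩

theorem add_mem_lengths_add {A B : Multiset G} {k m : ℕ} (hk : k ∈ lengths A)
    (hm : m ∈ lengths B) : k + m ∈ lengths (A + B) := by
  obtain ⟨s, hs, rfl, rfl⟩ := hk
  obtain ⟨t, ht, rfl, rfl⟩ := hm
  exact ⟨s + t, fun u hu => (Multiset.mem_add.1 hu).elim (hs u) (ht u), by simp, by simp⟩

theorem IsProductOneAtom.one_mem_lengths {U : Multiset G} (hU : IsProductOneAtom U) :
    1 ∈ lengths U :=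
  ⟨{U}, by simpa using hU, by simp, by simp⟩

theorem two_mem_lengths_iff {S : Multiset G} :
    2 ∈ lengths S ↔ ∃ U V, IsProductOneAtom U ∧ IsProductOneAtom V ∧ U + V = S := by
  constructor
  · rintro ⟨s, hs, hc, hsum⟩
    obtain ⟨U, V, rfl⟩ := Multiset.card_eq_two.1 hc
    exact ⟨U, V, hs U (by simp), hs V (by simp), by simpa using hsum⟩
  · rintro ⟨U, V, hU, hV, rfl⟩
    exact add_mem_lengths_add hU.one_mem_lengths hV.one_mem_lengths

theorem IsProductOneAtom.eq_one_of_mem_lengths {U : Multiset G} (hU : IsProductOneAtom U) {k : ℕ}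
    (hk : k ∈ lengths U) : k = 1 := by
  obtain ⟨s, hs, rfl, hsum⟩ := hk
  obtain ⟨T, hT⟩ := Multiset.exists_mem_of_ne_zero (s := s)
    (by rintro rfl; exact hU.ne_zero hsum.symm)
  obtain ⟨t, rfl⟩ := Multiset.exists_cons_of_mem hT
  rw [Multiset.sum_cons] at hsum
  have ht : ∀ u ∈ t, IsProductOneAtom u := fun u hu => hs u (Multiset.mem_cons_of_mem hu)
  have ht0 : t.sum = 0 := (hU.eq_zero_or_eq_zero (hs T hT).mem_productOne
    (mem_productOne_of_mem_lengths ⟨t, ht, rfl, rfl⟩) hsum).resolve_left (hs T hT).ne_zero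
  have : t = 0 := Multiset.eq_zero_of_forall_notMem fun u hu =>
    (ht u hu).ne_zero (Multiset.le_zero.1 (ht0 ▸ Multiset.le_sum_of_mem hu))
  rw [this, Multiset.card_cons, Multiset.card_zero]

theorem card_eq_two_of_sum_eq_add {s : Multiset (Multiset G)} (hs : ∀ u ∈ s, IsProductOneAtom u)
    {U V : Multiset G} (hU : U ∈ s) (hV : IsProductOneAtom V) (hsum : s.sum = U + V) :
    s.card = 2 := by
  obtain ⟨t, rfl⟩ := Multiset.exists_cons_of_mem hU
  rw [Multiset.sum_cons, add_right_inj] at hsum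
  rw [Multiset.card_cons, hV.eq_one_of_mem_lengths
    ⟨t, fun u hu => hs u (Multiset.mem_cons_of_mem hu), rfl, hsum⟩]

theorem cons_add_map_inv (a : G) (X : Multiset G) :
    a ::ₘ X + (a ::ₘ X).map (·⁻¹) = {a, a⁻¹} + (X + X.map (·⁻¹)) := by
  rw [Multiset.map_cons, Multiset.insert_eq_cons]
  simp only [← Multiset.singleton_add]
  abel

theorem card_mem_lengths_add_map_inv {X : Multiset G} (h1 : (1 : G) ∉ X) :
    X.card ∈ lengths (X + X.map (·⁻¹)) := by
  induction X using Multiset.induction_on with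
  | empty => exact ⟨0, by simp, rfl, rfl⟩
  | cons a X ih =>
    rw [Multiset.mem_cons, not_or] at h1
    rw [cons_add_map_inv, Multiset.card_cons, add_comm X.card]
    exact add_mem_lengths_add (isProductOneAtom_pair (Ne.symm h1.1)).one_mem_lengths (ih h1.2)

theorem exists_sum_eq_add_map_inv {s : Multiset (Multiset G)} (hs : ∀ u ∈ s, u ∈ productOne G)
    (hs2 : ∀ u ∈ s, u.card = 2) : ∃ X : Multiset G, s.sum = X + X.map (·⁻¹) := by
  induction s using Multiset.induction_on with
  | empty => exact ⟨0, rfl⟩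
  | cons u s ih =>
    rw [Multiset.forall_mem_cons] at hs hs2
    obtain ⟨X, hX⟩ := ih hs.2 hs2.2
    obtain ⟨x, rfl⟩ := exists_eq_pair_of_card_eq_two hs.1 hs2.1
    exact ⟨x ::ₘ X, by rw [Multiset.sum_cons, hX, cons_add_map_inv]⟩

theorem two_add_card_mem_lengths {T R : Multiset G} (hT : IsProductOneAtom T)
    (h1 : (1 : G) ∉ R) : 2 + R.card ∈ lengths (T + R + (T + R).map (·⁻¹)) := by
  rw [Multiset.map_add, add_add_add_comm]
  exact add_mem_lengths_add (two_mem_lengths_iff.2 ⟨T, _, hT, hT.map_inv, rfl⟩)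
    (card_mem_lengths_add_map_inv h1)

theorem IsProductOneAtom.two_card_subset_lengths {U : Multiset G} (hU : IsProductOneAtom U)
    (h1 : (1 : G) ∉ U) : {2, U.card} ⊆ lengths (U + U.map (·⁻¹)) := by
  rintro k (rfl | rfl)
  · exact two_mem_lengths_iff.2 ⟨U, _, hU, hU.map_inv, rfl⟩
  · exact card_mem_lengths_add_map_inv h1

theorem IsProductOneAtom.lengths_add_map_inv_eq {U : Multiset G} (hU : IsProductOneAtom U)
    (h1 : (1 : G) ∉ U) (h : ∀ T ≤ U + U.map (·⁻¹), IsProductOneAtom T →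
      T.card = 2 ∨ T = U ∨ T = U.map (·⁻¹)) :
    lengths (U + U.map (·⁻¹)) = {2, U.card} := by
  refine Set.Subset.antisymm ?_ (hU.two_card_subset_lengths h1)
  rintro k ⟨s, hs, rfl, hsum⟩
  by_cases hs2 : ∀ u ∈ s, u.card = 2
  · have hc := congrArg Multiset.card hsum
    rw [card_sum_eq_card_mul hs2, Multiset.card_add, Multiset.card_map] at hc
    exact Or.inr (show s.card = U.card by omega)
  · push Not at hs2
    obtain ⟨u, hu, hu2⟩ := hs2
    rcases (h u (hsum ▸ Multiset.le_sum_of_mem hu) (hs u hu)).resolve_left hu2 with rfl | rfl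
    · exact Or.inl (card_eq_two_of_sum_eq_add hs hu hU.map_inv hsum)
    · exact Or.inl (card_eq_two_of_sum_eq_add hs hu hU (hsum.trans (add_comm _ _)))

theorem one_notMem_of_two_mem_lengths {S : Multiset G} {k : ℕ} (h2 : 2 ∈ lengths S)
    (hk : k ∈ lengths S) (hk2 : k ≠ 2) : (1 : G) ∉ S := by
  obtain ⟨U, V, hU, hV, rfl⟩ := two_mem_lengths_iff.1 h2
  obtain ⟨s, hs, rfl, hsum⟩ := hk
  intro h
  wlog hmem : (1 : G) ∈ U generalizing U V
  · exact this V U hV hU (add_comm U V ▸ h2) (hsum.trans (add_comm U V)) (add_comm U V ▸ h)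
      ((Multiset.mem_add.1 h).resolve_left hmem)
  obtain ⟨T, hT, h1T⟩ := Multiset.mem_join.1 (show (1 : G) ∈ s.sum from hsum ▸ h)
  have hTU : T = U := by rw [(hs T hT).eq_singleton_one h1T, hU.eq_singleton_one hmem]
  exact hk2 (card_eq_two_of_sum_eq_add hs (hTU ▸ hT) hV hsum)

theorem two_le_card_of_one_notMem_sum {s : Multiset (Multiset G)} (hs : ∀ u ∈ s, IsProductOneAtom u)
    (h1 : (1 : G) ∉ s.sum) : ∀ u ∈ s, 2 ≤ u.card := fun u hu =>
  (hs u hu).two_le_card fun h => h1 (Multiset.mem_join.2 ⟨u, hu, h⟩)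

variable [Finite G]

theorem le_davenport_of_two_mem_lengths {S : Multiset G} {k : ℕ} (h2 : 2 ∈ lengths S)
    (hk : k ∈ lengths S) (hk2 : k ≠ 2) : k ≤ davenport G := by
  have h1 := one_notMem_of_two_mem_lengths h2 hk hk2
  obtain ⟨U, V, hU, hV, rfl⟩ := two_mem_lengths_iff.1 h2
  obtain ⟨s, hs, rfl, hsum⟩ := hk
  have hc := card_mul_le_card_sum (two_le_card_of_one_notMem_sum hs (hsum ▸ h1))
  rw [hsum, Multiset.card_add] at hc
  have := hU.card_le_davenport
  have := hV.card_le_davenport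
  omega

/- The two atoms have at most `D` terms each, the `D` atoms at least two, so all these bounds are
sharp and the `D` atoms are pairs `x, x⁻¹`. -/
theorem exists_add_eq_of_two_davenport_subset_lengths {S : Multiset G} (hD : davenport G ≠ 2)
    (h : {2, davenport G} ⊆ lengths S) :
    ∃ U V X : Multiset G, IsProductOneAtom U ∧ IsProductOneAtom V ∧
      U.card = davenport G ∧ V.card = davenport G ∧ U + V = S ∧ X + X.map (·⁻¹) = S := by
  obtain ⟨h2, hk⟩ := Set.pair_subset_iff.1 h
  have h1 := one_notMem_of_two_mem_lengths h2 hk hD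
  obtain ⟨U, V, hU, hV, rfl⟩ := two_mem_lengths_iff.1 h2
  obtain ⟨s, hs, hc, hsum⟩ := hk
  have hs2 := two_le_card_of_one_notMem_sum hs (hsum ▸ h1)
  have hcard := card_mul_le_card_sum hs2
  have hle := card_eq_of_card_sum_le hs2
  rw [hsum, Multiset.card_add] at hcard hle
  have := hU.card_le_davenport
  have := hV.card_le_davenport
  obtain ⟨X, hX⟩ := exists_sum_eq_add_map_inv (fun u hu => (hs u hu).mem_productOne)
    fun u hu => hle (by omega) hu
  exact ⟨U, V, X, hU, hV, by omega, by omega, rfl, by rw [← hX, hsum]⟩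

theorem exists_two_davenport_subset_mem_systemOfLengths (hD : 2 ≤ davenport G) :
    ∃ L ∈ systemOfLengths G, {2, davenport G} ⊆ L := by
  obtain ⟨U, hU, hc⟩ := exists_isProductOneAtom_card_eq_davenport G
  have hsub := hU.two_card_subset_lengths (hU.one_notMem (hc ▸ hD))
  rw [hc] at hsub
  exact ⟨_, lengths_mem_systemOfLengths (mem_productOne_of_mem_lengths (hsub (Or.inl rfl))), hsub⟩

theorem davenport_le_of_systemOfLengths_eq {H : Type*} [Group H] [Finite H]
    (h : systemOfLengths G = systemOfLengths H) (hD : 3 ≤ davenport G) :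
    davenport G ≤ davenport H := by
  obtain ⟨L, hL, hsub⟩ := exists_two_davenport_subset_mem_systemOfLengths (G := G) (by omega)
  obtain ⟨S, rfl⟩ := exists_lengths_eq_of_mem_systemOfLengths (h ▸ hL)
  obtain ⟨h2, hk⟩ := Set.pair_subset_iff.1 hsub
  exact le_davenport_of_two_mem_lengths h2 hk (by omega)

theorem davenport_eq_of_systemOfLengths_eq {H : Type*} [Group H] [Finite H]
    (h : systemOfLengths G = systemOfLengths H) (hD : 3 ≤ davenport G) :
    davenport G = davenport H := by
  have hle := davenport_le_of_systemOfLengths_eq h hD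
  exact hle.antisymm (davenport_le_of_systemOfLengths_eq h.symm (hD.trans hle))

end Lengths

/-- A sequence in which neither `1` nor a pair of mutually inverse terms occurs; such a pair may
consist of two copies of an element of order two. -/
structure IsInverseFree {G : Type*} [Group G] (S : Multiset G) : Prop where
  one_notMem : (1 : G) ∉ S
  not_pair_le : ∀ x : G, ¬ {x, x⁻¹} ≤ S

section InverseFree

variable {G : Type*} [Group G]

theorem isInverseFree_of_forall_inv_notMem {S : Multiset G} (h : ∀ x ∈ S, x⁻¹ ∉ S) :
    IsInverseFree S where
  one_notMem h1 := h 1 h1 (by rwa [inv_one])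
  not_pair_le x hx := h x (Multiset.mem_of_le hx (by simp)) (Multiset.mem_of_le hx (by simp))

theorem IsMinimalProductOne.isInverseFree {U : Multiset G} (hU : IsMinimalProductOne U)
    (hc : 3 ≤ U.card) : IsInverseFree U where
  one_notMem := hU.isProductOneAtom.one_notMem (by omega)
  not_pair_le x hx := by
    have hxU := hU.eq_of_le ⟨pair_mem_productOne_iff.2 (mul_inv_cancel x), by simp⟩ hx
    rw [← hxU, Multiset.card_pair] at hc
    omega

namespace IsInverseFree

variable {S : Multiset G}

theorem three_le_card_of_le (hS : IsInverseFree S) {T : Multiset G} (hT : IsProductOneAtom T)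
    (hTS : T ≤ S) : 3 ≤ T.card := by
  have h2 := hT.two_le_card fun h => hS.one_notMem (Multiset.mem_of_le hTS h)
  by_contra! h3
  obtain ⟨x, rfl⟩ := exists_eq_pair_of_card_eq_two hT.mem_productOne (by omega)
  exact hS.not_pair_le x hTS

theorem inv_notMem (hS : IsInverseFree S) {x : G} (hx : x⁻¹ ≠ x) (hxS : x ∈ S) : x⁻¹ ∉ S :=
  fun h => hS.not_pair_le x ((Multiset.le_iff_subset (by simpa using hx.symm)).2 (by
    simp [Multiset.insert_eq_cons, hxS, h]))

theorem count_le_one [DecidableEq G] (hS : IsInverseFree S) {x : G} (hx : x⁻¹ = x) :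
    S.count x ≤ 1 := by
  by_contra! h
  refine hS.not_pair_le x ?_
  rw [hx]
  exact Multiset.le_count_iff_replicate_le.1 h

theorem replicate_inv_add {x : G} {p : ℕ} {R : Multiset G}
    (h : IsInverseFree (Multiset.replicate p x + R)) (hx : x⁻¹ ≠ x) (hxR : x ∉ R) :
    IsInverseFree (Multiset.replicate p x⁻¹ + R) := by
  have hxV : x ∉ Multiset.replicate p x⁻¹ + R := fun hmem =>
    (Multiset.mem_add.1 hmem).elim (fun hm => hx (Multiset.eq_of_mem_replicate hm).symm) hxR
  refine ⟨fun h1 => ?_, fun y hy => ?_⟩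
  · rcases Multiset.mem_add.1 h1 with h1 | h1
    · have hx1 : x = 1 := inv_eq_one.1 (Multiset.eq_of_mem_replicate h1).symm
      exact hx (by rw [hx1, inv_one])
    · exact h.one_notMem (Multiset.mem_add.2 (Or.inr h1))
  · obtain ⟨A, hA, B, hB, hAB⟩ := exists_le_add_le_of_le_add hy
    obtain ⟨i, -, rfl⟩ := Multiset.le_replicate_iff.1 hA
    rcases Nat.eq_zero_or_pos i with rfl | hi
    · rw [Multiset.replicate_zero, zero_add] at hAB
      exact h.not_pair_le y (hAB ▸ hB.trans (Multiset.le_add_left _ _))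
    · have hmem : x⁻¹ ∈ ({y, y⁻¹} : Multiset G) := by
        rw [← hAB]
        exact Multiset.mem_add.2 (Or.inl (Multiset.mem_replicate.2 ⟨hi.ne', rfl⟩))
      have hxmem : x ∈ ({y, y⁻¹} : Multiset G) := by
        simpa [Multiset.insert_eq_cons, or_comm, inv_eq_iff_eq_inv] using hmem
      exact hxV (Multiset.mem_of_le hy hxmem)

theorem eq_map_inv_of_add_eq {U V X : Multiset G} (hU : IsInverseFree U) (hV : IsInverseFree V)
    (h : U + V = X + X.map (·⁻¹)) : V = U.map (·⁻¹) := by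
  classical
  have count_inv : ∀ (Z : Multiset G) (g : G), (Z.map (·⁻¹)).count g = Z.count g⁻¹ := fun Z g => by
    simpa using Multiset.count_map_eq_count' (·⁻¹) Z inv_injective g⁻¹
  have count_sum : ∀ g, U.count g + V.count g = X.count g + X.count g⁻¹ := fun g => by
    rw [← Multiset.count_add, h, Multiset.count_add, count_inv]
  ext g
  rw [count_inv]
  have hg := count_sum g
  have hg' := count_sum g⁻¹
  rw [inv_inv] at hg'
  by_cases hinv : g⁻¹ = g
  · have := hU.count_le_one hinv
    have := hV.count_le_one hinv
    rw [hinv] at hg ⊢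
    omega
  · have count_eq_zero : ∀ {Z : Multiset G}, IsInverseFree Z → Z.count g = 0 ∨ Z.count g⁻¹ = 0 :=
      fun hZ => by
        simpa only [Multiset.count_eq_zero, ← imp_iff_not_or, not_not] using hZ.inv_notMem hinv
    have := count_eq_zero hU
    have := count_eq_zero hV
    omega

end IsInverseFree

theorem map_add_map_inv_map_eq {f : G → G} (hf : ∀ x, f x = x ∨ f x = x⁻¹) (X : Multiset G) :
    X.map f + (X.map f).map (·⁻¹) = X + X.map (·⁻¹) := by
  induction X using Multiset.induction_on with
  | empty => rfl
  | cons a X ih =>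
    rw [Multiset.map_cons, cons_add_map_inv, cons_add_map_inv, ih]
    rcases hf a with h | h
    · rw [h]
    · rw [h, inv_inv, Multiset.pair_comm]

theorem inv_ne_self_of_odd_card (hodd : Odd (Nat.card G)) {x : G} (hx : x ≠ 1) : x⁻¹ ≠ x :=
  fun h => hx <| (Nat.Coprime.pow_left_bijective
    (Nat.coprime_two_right.2 hodd)).injective (by simp [sq, ← inv_eq_iff_mul_eq_one, h])

theorem exists_isInverseFree_add_map_inv_eq (hodd : Odd (Nat.card G)) {X : Multiset G}
    (h1 : (1 : G) ∉ X) : ∃ Y : Multiset G, IsInverseFree Y ∧ Y + Y.map (·⁻¹) = X + X.map (·⁻¹) := by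
  let _ : LinearOrder G := WellOrderingRel.isWellOrder.linearOrder
  let f : G → G := fun x => min x x⁻¹
  have hf : ∀ x, f x = x ∨ f x = x⁻¹ := fun x => min_choice x x⁻¹
  have hf_inv : ∀ x, f x⁻¹ = f x := fun x => by simp only [f, inv_inv, min_comm]
  have hf_idem : ∀ x, f (f x) = f x := fun x => by
    rcases hf x with h | h <;> simp only [h, hf_inv]
  refine ⟨X.map f, isInverseFree_of_forall_inv_notMem fun y hy hy' => ?_,
    map_add_map_inv_map_eq hf X⟩
  obtain ⟨u, hu, rfl⟩ := Multiset.mem_map.1 hy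
  obtain ⟨v, -, hv⟩ := Multiset.mem_map.1 hy'
  have hinv : (f u)⁻¹ = f u := by rw [← hv, ← hf_idem v, hv, hf_inv, hf_idem]
  have hone : f u = 1 := by_contra fun h => inv_ne_self_of_odd_card hodd h hinv
  have hu1 : u = 1 := by
    rcases hf u with h | h
    · exact h.symm.trans hone
    · exact inv_eq_one.1 (h.symm.trans hone)
  exact h1 (hu1 ▸ hu)

end InverseFree

section LargeDavenport

variable {G : Type*} [Group G] [Finite G]

theorem exists_add_eq_coe_of_davenport_le_length (l : List G) (hl : davenport G ≤ l.length) :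
    ∃ A B : Multiset G, A + B = l ∧ B ≠ 0 ∧ B ∈ productOne G ∧ l.prod⁻¹ ::ₘ A ∈ productOne G := by
  by_contra! H
  have hatom : IsProductOneAtom (l.prod⁻¹ ::ₘ (l : Multiset G)) := by
    refine ⟨cons_mem_productOne_iff.2 ⟨l, rfl, inv_mul_cancel _⟩, Multiset.cons_ne_zero,
      fun A hA B hB hAB => ?_⟩
    wlog hmem : l.prod⁻¹ ∈ A generalizing A B
    · refine (this B hB A hA (by rwa [add_comm]) ?_).symm
      exact (Multiset.mem_add.1 (hAB ▸ Multiset.mem_cons_self _ _)).resolve_left hmem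
    obtain ⟨A, rfl⟩ := Multiset.exists_cons_of_mem hmem
    rw [Multiset.cons_add, Multiset.cons_inj_right] at hAB
    by_contra! h0
    exact H A B hAB h0.2 hB hA
  have := hatom.card_le_davenport
  rw [Multiset.card_cons, Multiset.coe_card] at this
  omega

theorem exists_isMinimalProductOne_le_of_davenport_le_card {Z : Multiset G}
    (hZ : davenport G ≤ Z.card) : ∃ T ≤ Z, IsMinimalProductOne T := by
  obtain ⟨l, rfl⟩ : ∃ l : List G, (l : Multiset G) = Z := Quot.exists_rep Z
  obtain ⟨A, B, hAB, hB0, hB, -⟩ := exists_add_eq_coe_of_davenport_le_length l hZ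
  obtain ⟨T, hT, hmin⟩ := exists_isMinimalProductOne_le hB hB0
  exact ⟨T, hT.trans (hAB ▸ Multiset.le_add_left B A), hmin⟩

theorem IsInverseFree.isMinimalProductOne {X : Multiset G} (hX : IsInverseFree X)
    (hc : X.card = davenport G) (hL : lengths (X + X.map (·⁻¹)) ⊆ {2, davenport G}) :
    IsMinimalProductOne X := by
  obtain ⟨T, hT, hmin⟩ := exists_isMinimalProductOne_le_of_davenport_le_card hc.ge
  have hT3 := hX.three_le_card_of_le hmin.isProductOneAtom hT
  obtain ⟨R, rfl⟩ := Multiset.le_iff_exists_add.1 hT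
  have hR : (1 : G) ∉ R := fun h => hX.one_notMem (Multiset.mem_add.2 (Or.inr h))
  rw [Multiset.card_add] at hc
  rcases hL (two_add_card_mem_lengths hmin.isProductOneAtom hR) with h | h
  · rwa [Multiset.card_eq_zero.1 (show R.card = 0 by omega), add_zero]
  · rw [Set.mem_singleton_iff] at h
    omega

namespace IsMinimalProductOne

variable {X : Multiset G}

/- Splitting `g⁻¹, l` with `g = l.prod` gives a product-one subsequence of `l`, hence all of `l`,
so that the remaining part `g⁻¹` is itself product-one. -/
theorem prod_eq_one (hX : IsMinimalProductOne X) (hc : X.card = davenport G) {l : List G}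
    (hl : (l : Multiset G) = X) : l.prod = 1 := by
  subst hl
  obtain ⟨A, B, hAB, hB0, hB, hA⟩ := exists_add_eq_coe_of_davenport_le_length l hc.ge
  have hBX := hX.eq_of_le ⟨hB, hB0⟩ (hAB ▸ Multiset.le_add_left B A)
  have hA0 : A = 0 := add_eq_right.1 (hAB.trans hBX.symm)
  rwa [hA0, Multiset.cons_zero, ← Multiset.replicate_one, replicate_mem_productOne_iff, pow_one,
    inv_eq_one] at hA

theorem commute (hX : IsMinimalProductOne X) (hc : X.card = davenport G) {x y : G}
    (hx : x ∈ X) (hy : y ∈ X) : Commute x y := by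
  rcases eq_or_ne y x with rfl | hne
  · exact Commute.refl y
  obtain ⟨Y, rfl⟩ := Multiset.exists_cons_of_mem hx
  obtain ⟨Z, rfl⟩ := Multiset.exists_cons_of_mem ((Multiset.mem_cons.1 hy).resolve_left hne)
  obtain ⟨l, rfl⟩ : ∃ l : List G, (l : Multiset G) = Z := Quot.exists_rep Z
  have hxy := hX.prod_eq_one hc (l := x :: y :: l) rfl
  have hyx := hX.prod_eq_one hc (l := y :: x :: l) (Multiset.cons_swap y x (l : Multiset G))
  rw [List.prod_cons, List.prod_cons, ← mul_assoc] at hxy hyx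
  exact mul_right_cancel (hxy.trans hyx.symm)

/- Replacing a term of `X` by `g⁻¹` leaves a sequence of maximal length, whose product-one
subsequence must contain `g⁻¹` by minimality and expresses `g` by terms of `X`. -/
theorem subgroup_eq_top (hX : IsMinimalProductOne X) (hc : X.card = davenport G)
    {H : Subgroup G} (hH : ∀ x ∈ X, x ∈ H) : H = ⊤ := by
  refine (Subgroup.eq_top_iff' H).2 fun g => ?_
  obtain ⟨x, hx⟩ := Multiset.exists_mem_of_ne_zero hX.prop.2
  obtain ⟨Y, rfl⟩ := Multiset.exists_cons_of_mem hx
  obtain ⟨T, hT, hmin⟩ := exists_isMinimalProductOne_le_of_davenport_le_card (Z := g⁻¹ ::ₘ Y)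
    (by rw [← hc, Multiset.card_cons, Multiset.card_cons])
  by_cases hg : g⁻¹ ∈ T
  · obtain ⟨T, rfl⟩ := Multiset.exists_cons_of_mem hg
    obtain ⟨l, rfl, hl⟩ := cons_mem_productOne_iff.1 hmin.prop.1
    rw [inv_mul_eq_one.1 hl]
    exact Subgroup.list_prod_mem H fun y hy => hH y <| Multiset.mem_cons_of_mem <|
      Multiset.mem_of_le ((Multiset.cons_le_cons_iff _).1 hT) hy
  · have hTY : T ≤ Y := (Multiset.le_cons_of_notMem hg).1 hT
    have hTX := hX.eq_of_le hmin.prop (hTY.trans (Multiset.le_cons_self Y x))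
    have := Multiset.card_le_card hTY
    rw [hTX, Multiset.card_cons] at this
    omega

theorem center_eq_top (hX : IsMinimalProductOne X) (hc : X.card = davenport G) :
    Subgroup.center G = ⊤ := by
  have hcentral : Subgroup.centralizer {x | x ∈ X} = ⊤ := hX.subgroup_eq_top hc fun x hx =>
    Subgroup.mem_centralizer_iff.2 fun y hy => hX.commute hc hy hx
  refine hX.subgroup_eq_top hc fun x hx => Subgroup.mem_center_iff.2 fun g => ?_
  have hg : g ∈ Subgroup.centralizer {x | x ∈ X} := hcentral ▸ Subgroup.mem_top g
  exact (Subgroup.mem_centralizer_iff.1 hg x hx).symm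

end IsMinimalProductOne

end LargeDavenport

theorem IsMinimalProductOne.injective_prod_take {G : Type*} [Group G] {l : List G}
    (hl : IsMinimalProductOne (l : Multiset G)) :
    Function.Injective fun i : Fin l.length => (l.take i).prod := by
  intro i j (hij : (l.take i).prod = (l.take j).prod)
  wlog hlt : i < j generalizing i j
  · by_contra hne
    exact hne (this hij.symm (lt_of_le_of_ne (not_lt.1 hlt) (Ne.symm hne))).symm
  set m := (l.take j).drop i
  have hm : m.prod = 1 := by
    have hsplit := List.prod_take_mul_prod_drop (l.take j) i
    rwa [List.take_take, min_eq_left (Fin.lt_def.1 hlt).le, hij, mul_eq_left] at hsplit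
  have hlen : m.length = j - i := by
    rw [List.length_drop, List.length_take, min_eq_left j.2.le]
  have hm0 : (m : Multiset G) ≠ 0 := by
    rw [← Multiset.card_pos, Multiset.coe_card, hlen]
    exact Nat.sub_pos_of_lt hlt
  have heq := hl.eq_of_le ⟨⟨m, rfl, hm⟩, hm0⟩
    (Multiset.coe_le.2 ((List.drop_sublist _ _).trans (List.take_sublist _ _)).subperm)
  have hc := congrArg Multiset.card heq
  rw [Multiset.coe_card, Multiset.coe_card, hlen] at hc
  omega

theorem isMinimalProductOne_replicate_orderOf {G : Type*} [Group G] {x : G} (hx : IsOfFinOrder x) :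
    IsMinimalProductOne (Multiset.replicate (orderOf x) x) := by
  obtain ⟨T, hT, hmin⟩ := exists_isMinimalProductOne_le
    (replicate_mem_productOne_iff.2 (pow_orderOf_eq_one x))
    (Multiset.card_pos.1 (by simpa using hx.orderOf_pos))
  obtain ⟨j, hj, rfl⟩ := Multiset.le_replicate_iff.1 hT
  have hj0 : 0 < j := by simpa using Multiset.card_pos.2 hmin.prop.2
  have hdvd := orderOf_dvd_of_pow_eq_one (replicate_mem_productOne_iff.1 hmin.prop.1)
  rwa [hj.antisymm (Nat.le_of_dvd hj0 hdvd)] at hmin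

section Comm

variable {G : Type*} [CommGroup G]

theorem IsProductOneAtom.isMinimalProductOne {U : Multiset G} (hU : IsProductOneAtom U) :
    IsMinimalProductOne U := by
  obtain ⟨T, hT, hmin⟩ := exists_isMinimalProductOne_le hU.mem_productOne hU.ne_zero
  obtain ⟨R, rfl⟩ := Multiset.le_iff_exists_add.1 hT
  have hR : R ∈ productOne G := by
    have h := mem_productOne_iff_prod_eq_one.1 hU.mem_productOne
    rw [Multiset.prod_add, mem_productOne_iff_prod_eq_one.1 hmin.prop.1, one_mul] at h
    exact mem_productOne_iff_prod_eq_one.2 h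
  have hR0 := (hU.eq_zero_or_eq_zero hmin.prop.1 hR rfl).resolve_left hmin.prop.2
  rwa [hR0, add_zero]

theorem IsMinimalProductOne.eq_of_isProductOneAtom_le {U T : Multiset G}
    (hU : IsMinimalProductOne U) (hT : IsProductOneAtom T) (hTU : T ≤ U) : T = U :=
  hU.eq_of_le ⟨hT.mem_productOne, hT.ne_zero⟩ hTU

theorem IsMinimalProductOne.lengths_replicate_add_map_inv {x : G} {m : ℕ}
    (hU : IsMinimalProductOne (Multiset.replicate m x)) (hm : 2 ≤ m) :
    lengths (Multiset.replicate m x + (Multiset.replicate m x).map (·⁻¹)) = {2, m} := by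
  have hatom := hU.isProductOneAtom
  have h1 := hatom.one_notMem (by rwa [Multiset.card_replicate])
  have hx : x ≠ 1 := fun h => h1 (Multiset.mem_replicate.2 ⟨by omega, h.symm⟩)
  have hU' := hatom.map_inv.isMinimalProductOne
  rw [hatom.lengths_add_map_inv_eq h1, Multiset.card_replicate]
  rw [Multiset.map_replicate] at hU' ⊢
  intro T hT hTatom
  obtain ⟨A, hA, B, hB, rfl⟩ := exists_le_add_le_of_le_add hT
  obtain ⟨i, -, rfl⟩ := Multiset.le_replicate_iff.1 hA
  obtain ⟨j, -, rfl⟩ := Multiset.le_replicate_iff.1 hB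
  rcases Nat.eq_zero_or_pos i with rfl | hi
  · rw [Multiset.replicate_zero, zero_add] at hTatom ⊢
    exact Or.inr (Or.inr (hU'.eq_of_isProductOneAtom_le hTatom hB))
  rcases Nat.eq_zero_or_pos j with rfl | hj
  · rw [Multiset.replicate_zero, add_zero] at hTatom ⊢
    exact Or.inr (Or.inl (hU.eq_of_isProductOneAtom_le hTatom hA))
  have hpair : ({x, x⁻¹} : Multiset G) ≤ Multiset.replicate i x + Multiset.replicate j x⁻¹ :=
    add_le_add (Multiset.singleton_le.2 (Multiset.mem_replicate.2 ⟨hi.ne', rfl⟩))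
      (Multiset.singleton_le.2 (Multiset.mem_replicate.2 ⟨hj.ne', rfl⟩))
  left
  rw [← hTatom.isMinimalProductOne.eq_of_isProductOneAtom_le (isProductOneAtom_pair hx) hpair,
    Multiset.card_pair]

theorem IsProductOneAtom.lengths_add_map_inv_eq_of_forall_inv_eq_self {U : Multiset G}
    (hU : IsProductOneAtom U) (hc : 3 ≤ U.card) (hinv : ∀ g : G, g⁻¹ = g) :
    lengths (U + U.map (·⁻¹)) = {2, U.card} := by
  classical
  have hfree := hU.isMinimalProductOne.isInverseFree hc
  have hUinv : U.map (·⁻¹) = U := by simp only [hinv, Multiset.map_id']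
  refine hU.lengths_add_map_inv_eq hfree.one_notMem fun T hT hTatom => ?_
  rw [hUinv] at hT
  rcases (Nat.lt_or_ge T.card 3) with hlt | hge
  · exact Or.inl (by
      have h1 : (1 : G) ∉ T := fun h => hfree.one_notMem (by simpa using Multiset.mem_of_le hT h)
      have := hTatom.two_le_card h1
      omega)
  have hTfree := hTatom.isMinimalProductOne.isInverseFree hge
  have hnodup : T.Nodup := Multiset.nodup_iff_count_le_one.2 fun g => hTfree.count_le_one (hinv g)
  have hTU : T ≤ U := (Multiset.le_iff_subset hnodup).2 fun g hg => by
    simpa using Multiset.mem_of_le hT hg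
  exact Or.inr (Or.inl (hU.isMinimalProductOne.eq_of_isProductOneAtom_le hTatom hTU))

theorem replicate_inv_add_mem_productOne {x : G} {a d : ℕ} {A B : Multiset G}
    (h : Multiset.replicate a x + (A + B) ∈ productOne G)
    (hA : Multiset.replicate (a + d) x + A ∈ productOne G) :
    Multiset.replicate d x⁻¹ + B ∈ productOne G := by
  simp only [mem_productOne_iff_prod_eq_one, Multiset.prod_add, Multiset.prod_replicate] at *
  calc x⁻¹ ^ d * B.prod
      = x ^ a * (A.prod * B.prod) * (x ^ (a + d) * A.prod)⁻¹ := by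
        rw [eq_mul_inv_iff_mul_eq, inv_pow, mul_assoc, inv_mul_eq_iff_eq_mul, add_comm a, pow_add,
          mul_comm B.prod]
        simp only [mul_assoc]
    _ = 1 := by rw [h, hA, one_mul, inv_one]

section Finite

variable [Finite G]

/- Replacing the term `r` by `a - 1` copies of `x` yields a sequence of maximal length, hence with
a product-one subsequence `x ^ j * T`. If `j ≤ a`, it lies properly in the first sequence;
otherwise the terms it omits and `j - a` copies of `x⁻¹` form a product-one sequence that lies
properly in the second one. -/
theorem IsMinimalProductOne.eq_zero_of_replicate_inv_add {x : G} (hx : x⁻¹ ≠ x) {a : ℕ}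
    (ha : 0 < a) {R : Multiset G} (h : IsMinimalProductOne (Multiset.replicate a x + R))
    (h' : IsMinimalProductOne (Multiset.replicate a x⁻¹ + R))
    (hc : (Multiset.replicate a x + R).card = davenport G) : R = 0 := by
  by_contra hR0
  obtain ⟨r, hr⟩ := Multiset.exists_mem_of_ne_zero hR0
  obtain ⟨Q, rfl⟩ := Multiset.exists_cons_of_mem hr
  have hprod := mem_productOne_iff_prod_eq_one.1 h.prop.1
  have hprod' := mem_productOne_iff_prod_eq_one.1 h'.prop.1
  rw [Multiset.prod_add, Multiset.prod_replicate] at hprod hprod'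
  have ha2 : 2 ≤ a := by
    by_contra hlt
    obtain rfl : a = 1 := by omega
    rw [pow_one] at hprod hprod'
    exact hx (mul_right_cancel (hprod'.trans hprod.symm))
  rw [Multiset.card_add, Multiset.card_replicate, Multiset.card_cons] at hc
  obtain ⟨Z, hZ, hmin⟩ := exists_isMinimalProductOne_le_of_davenport_le_card
    (Z := Multiset.replicate (2 * a - 1) x + Q)
    (by rw [Multiset.card_add, Multiset.card_replicate]; omega)
  obtain ⟨J, hJ, T, hT, rfl⟩ := exists_le_add_le_of_le_add hZ
  obtain ⟨j, hj, rfl⟩ := Multiset.le_replicate_iff.1 hJ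
  have hjT := mem_productOne_iff_prod_eq_one.1 hmin.prop.1
  rw [Multiset.prod_add, Multiset.prod_replicate] at hjT
  obtain ⟨V, rfl⟩ := Multiset.le_iff_exists_add.1 hT
  rcases le_or_gt j a with hja | hja
  · have heq := h.eq_of_le hmin.prop
      (add_le_add (Multiset.replicate_mono x hja) (hT.trans (Multiset.le_cons_self _ r)))
    have := congrArg Multiset.card heq
    simp only [Multiset.card_add, Multiset.card_replicate, Multiset.card_cons] at this
    omega
  · obtain ⟨d, rfl⟩ := Nat.exists_eq_add_of_le hja.le
    rw [← Multiset.add_cons] at h h'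
    have hmem := replicate_inv_add_mem_productOne h.prop.1 hmin.prop.1
    have heq := h'.eq_of_le ⟨hmem, by simp⟩
      (add_le_add (Multiset.replicate_mono _ (by omega)) (Multiset.le_add_left _ T))
    have := congrArg Multiset.card heq
    simp only [Multiset.card_add, Multiset.card_replicate, Multiset.card_cons] at this
    omega

/- Replacing all copies of `x` by `x⁻¹` does not change `X + X.map (·⁻¹)`, so the resulting sequence
is a minimal product-one sequence as well. -/
theorem IsInverseFree.eq_replicate {X : Multiset G} (hX : IsInverseFree X)
    (hc : X.card = davenport G) (hL : lengths (X + X.map (·⁻¹)) ⊆ {2, davenport G}) {x : G}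
    (hxX : x ∈ X) (hx : x⁻¹ ≠ x) : X = Multiset.replicate (davenport G) x := by
  classical
  obtain ⟨a, R, ha, hxR, rfl⟩ : ∃ a R, 0 < a ∧ x ∉ R ∧ X = Multiset.replicate a x + R := by
    refine ⟨X.count x, X.filter (fun y => ¬ x = y), Multiset.count_pos.2 hxX, by simp, ?_⟩
    rw [← Multiset.filter_eq X x, Multiset.filter_add_not]
  have hsum : Multiset.replicate a x⁻¹ + R + (Multiset.replicate a x⁻¹ + R).map (·⁻¹) =
      Multiset.replicate a x + R + (Multiset.replicate a x + R).map (·⁻¹) := by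
    simp only [Multiset.map_add, Multiset.map_replicate, inv_inv]
    abel
  have hmin' := (hX.replicate_inv_add hx hxR).isMinimalProductOne (by simpa using hc)
    (by rwa [hsum])
  have hR := (hX.isMinimalProductOne hc hL).eq_zero_of_replicate_inv_add hx ha hmin' hc
  rw [hR, add_zero, Multiset.card_replicate] at hc
  rw [hR, add_zero, hc]

theorem IsMinimalProductOne.isCyclic_and_card_eq {x : G}
    (h : IsMinimalProductOne (Multiset.replicate (davenport G) x)) :
    IsCyclic G ∧ Nat.card G = davenport G := by
  have htop : Subgroup.zpowers x = ⊤ := h.subgroup_eq_top (Multiset.card_replicate _ _)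
    fun y hy => by rw [Multiset.eq_of_mem_replicate hy]; exact Subgroup.mem_zpowers x
  refine ⟨⟨x, (Subgroup.eq_top_iff' _).1 htop⟩, davenport_le_card.antisymm' ?_⟩
  rw [← Subgroup.card_top, ← htop, Nat.card_zpowers]
  refine Nat.le_of_dvd (Nat.pos_of_ne_zero fun h0 => h.prop.2 (by rw [h0, Multiset.replicate_zero]))
    (orderOf_dvd_of_pow_eq_one (replicate_mem_productOne_iff.1 h.prop.1))

theorem isCyclic_and_card_eq_or_forall_inv_eq_self (hD : 3 ≤ davenport G)
    (h : {2, davenport G} ∈ systemOfLengths G) :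
    (IsCyclic G ∧ Nat.card G = davenport G) ∨ ∀ g : G, g⁻¹ = g := by
  obtain ⟨S, hS⟩ := exists_lengths_eq_of_mem_systemOfLengths h
  obtain ⟨U, V, X, hU, hV, hUc, hVc, hUV, hX⟩ :=
    exists_add_eq_of_two_davenport_subset_lengths (by omega) hS.superset
  have hfree := hU.isMinimalProductOne.isInverseFree (hUc ▸ hD)
  have hVU := hfree.eq_map_inv_of_add_eq (hV.isMinimalProductOne.isInverseFree (hVc ▸ hD))
    (hUV.trans hX.symm)
  have hL : lengths (U + U.map (·⁻¹)) ⊆ {2, davenport G} := by rw [← hVU, hUV, hS]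
  by_cases hinv : ∀ x ∈ U, x⁻¹ = x
  · have hker : (powMonoidHom 2 : G →* G).ker = ⊤ :=
      hU.isMinimalProductOne.subgroup_eq_top hUc fun x hx => by
        rw [MonoidHom.mem_ker, powMonoidHom_apply, sq, ← inv_eq_iff_mul_eq_one, hinv x hx]
    refine Or.inr fun g => ?_
    have hg : g ∈ (powMonoidHom 2 : G →* G).ker := hker ▸ Subgroup.mem_top g
    rwa [MonoidHom.mem_ker, powMonoidHom_apply, sq, ← inv_eq_iff_mul_eq_one] at hg
  · push Not at hinv
    obtain ⟨x, hxU, hx⟩ := hinv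
    have hrep := hfree.eq_replicate hUc hL hxU hx
    exact Or.inl (IsMinimalProductOne.isCyclic_and_card_eq (hrep ▸ hU.isMinimalProductOne))

/- If `h ≠ g` is a second term, `h` is the product of an initial segment of `g, h, …`, and
cancelling `h` from that product leaves a proper product-one subsequence. -/
theorem IsProductOneAtom.eq_replicate_of_card_eq {U : Multiset G} (hU : IsProductOneAtom U)
    (hc : U.card = Nat.card G) (h1 : (1 : G) ∉ U) {g : G} (hg : g ∈ U) :
    U = Multiset.replicate U.card g := by
  rw [Multiset.eq_replicate_card]
  intro h hh
  by_contra hne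
  obtain ⟨Y, rfl⟩ := Multiset.exists_cons_of_mem hg
  obtain ⟨Z, rfl⟩ := Multiset.exists_cons_of_mem ((Multiset.mem_cons.1 hh).resolve_left hne)
  obtain ⟨l, rfl⟩ : ∃ l : List G, (l : Multiset G) = Z := Quot.exists_rep Z
  have hmin : IsMinimalProductOne ((g :: h :: l : List G) : Multiset G) := hU.isMinimalProductOne
  have hbij := (Nat.bijective_iff_injective_and_card _).2
    ⟨hmin.injective_prod_take, by rw [← hc]; simp⟩
  obtain ⟨i, hprod⟩ : ∃ i : ℕ, ((g :: h :: l).take i).prod = h :=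
    (hbij.2 h).imp' Fin.val fun _ => id
  match i, hprod with
  | 0, hprod => exact h1 ((show (1 : G) = h by simpa using hprod) ▸ hh)
  | 1, hprod => exact hne (by simpa using hprod.symm)
  | i + 2, hprod =>
    have hp : (g :: l.take i).prod = 1 := by
      simpa only [List.take_succ_cons, List.prod_cons, mul_left_comm g, mul_eq_left] using hprod
    have hle : ((g :: l.take i : List G) : Multiset G) ≤ (g :: h :: l : List G) :=
      Multiset.coe_le.2 (((List.take_sublist i l).cons h).cons_cons g).subperm
    have heq := congrArg Multiset.card (hmin.eq_of_le ⟨⟨_, rfl, hp⟩, by simp⟩ hle)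
    simp only [Multiset.coe_card, List.length_cons, List.length_take] at heq
    omega

theorem lengths_add_map_inv_eq_of_two_davenport_mem_systemOfLengths (hD : 3 ≤ davenport G)
    (h : {2, davenport G} ∈ systemOfLengths G) {U : Multiset G} (hU : IsProductOneAtom U)
    (hc : U.card = davenport G) : lengths (U + U.map (·⁻¹)) = {2, davenport G} := by
  rcases isCyclic_and_card_eq_or_forall_inv_eq_self hD h with ⟨-, hcard⟩ | hinv
  · obtain ⟨g, hg⟩ := Multiset.exists_mem_of_ne_zero hU.ne_zero
    have hrep := hU.eq_replicate_of_card_eq (hc.trans hcard.symm) (hU.one_notMem (by omega)) hg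
    rw [hc] at hrep
    subst hrep
    exact hU.isMinimalProductOne.lengths_replicate_add_map_inv (by omega)
  · rw [hU.lengths_add_map_inv_eq_of_forall_inv_eq_self (hc ▸ hD) hinv, hc]

theorem eq_two_davenport_of_subset_of_mem_systemOfLengths (hD : 3 ≤ davenport G)
    (h : {2, davenport G} ∈ systemOfLengths G) {L : Set ℕ} (hL : L ∈ systemOfLengths G)
    (hsub : {2, davenport G} ⊆ L) : L = {2, davenport G} := by
  obtain ⟨S, rfl⟩ := exists_lengths_eq_of_mem_systemOfLengths hL
  obtain ⟨U, V, X, hU, hV, hUc, hVc, hUV, hX⟩ :=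
    exists_add_eq_of_two_davenport_subset_lengths (by omega) hsub
  have hVU := (hU.isMinimalProductOne.isInverseFree (hUc ▸ hD)).eq_map_inv_of_add_eq
    (hV.isMinimalProductOne.isInverseFree (hVc ▸ hD)) (hUV.trans hX.symm)
  rw [← hUV, hVU, lengths_add_map_inv_eq_of_two_davenport_mem_systemOfLengths hD h hU hUc]

end Finite

end Comm

section CyclicAndOdd

variable {G : Type*} [Group G] [Finite G]

theorem exists_isMinimalProductOne_replicate_card (G : Type*) [Group G] [Finite G] [IsCyclic G] :
    ∃ x : G, IsMinimalProductOne (Multiset.replicate (Nat.card G) x) := by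
  obtain ⟨x, hx⟩ := IsCyclic.exists_generator (α := G)
  refine ⟨x, ?_⟩
  rw [← orderOf_eq_card_of_forall_mem_zpowers hx]
  exact isMinimalProductOne_replicate_orderOf (isOfFinOrder_of_finite x)

theorem davenport_eq_card_of_isCyclic (G : Type*) [Group G] [Finite G] [IsCyclic G] :
    davenport G = Nat.card G := by
  obtain ⟨x, hx⟩ := exists_isMinimalProductOne_replicate_card G
  exact davenport_le_card.antisymm (by simpa using hx.isProductOneAtom.card_le_davenport)

theorem two_davenport_mem_systemOfLengths_of_isCyclic [IsCyclic G] (h2 : 2 ≤ Nat.card G) :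
    {2, davenport G} ∈ systemOfLengths G := by
  let _ : CommGroup G := IsCyclic.commGroup
  obtain ⟨x, hx⟩ := exists_isMinimalProductOne_replicate_card G
  have hL := hx.lengths_replicate_add_map_inv h2
  rw [davenport_eq_card_of_isCyclic, ← hL]
  exact lengths_mem_systemOfLengths (mem_productOne_of_mem_lengths (hL.superset (Or.inl rfl)))

theorem three_le_davenport_of_odd_card (h3 : 3 ≤ Nat.card G) (hodd : Odd (Nat.card G)) :
    3 ≤ davenport G := by
  have : Nontrivial G := Finite.one_lt_card_iff_nontrivial.1 (by omega)
  obtain ⟨x, hx⟩ := exists_ne (1 : G)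
  obtain ⟨m, hm⟩ := hodd.of_dvd_nat (orderOf_dvd_natCard x)
  have h1 : orderOf x ≠ 1 := fun h => hx (orderOf_eq_one_iff.1 h)
  have hatom := (isMinimalProductOne_replicate_orderOf (isOfFinOrder_of_finite x)).isProductOneAtom
  have := hatom.card_le_davenport
  rw [Multiset.card_replicate] at this
  omega

theorem isCyclic_and_card_eq_of_odd_card (h3 : 3 ≤ Nat.card G) (hodd : Odd (Nat.card G))
    (h : {2, davenport G} ∈ systemOfLengths G) : IsCyclic G ∧ Nat.card G = davenport G := by
  have hD := three_le_davenport_of_odd_card h3 hodd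
  obtain ⟨S, hS⟩ := exists_lengths_eq_of_mem_systemOfLengths h
  obtain ⟨U, V, X, hU, hV, hUc, hVc, hUV, hX⟩ :=
    exists_add_eq_of_two_davenport_subset_lengths (by omega) hS.superset
  have h1 : (1 : G) ∉ X := fun hmem => by
    have h1S : (1 : G) ∈ U + V := hUV ▸ hX ▸ Multiset.mem_add.2 (Or.inl hmem)
    exact (Multiset.mem_add.1 h1S).elim (hU.one_notMem (by omega)) (hV.one_notMem (by omega))
  obtain ⟨Y, hY, hYX⟩ := exists_isInverseFree_add_map_inv_eq hodd h1
  rw [hX] at hYX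
  have hYc : Y.card = davenport G := by
    have := congrArg Multiset.card (hYX.trans hUV.symm)
    simp only [Multiset.card_add, Multiset.card_map] at this
    omega
  have hmin := hY.isMinimalProductOne hYc (by rw [hYX, hS])
  let _ : CommGroup G := Group.commGroupOfCenterEqTop (hmin.center_eq_top hYc)
  refine (isCyclic_and_card_eq_or_forall_inv_eq_self hD h).resolve_right fun hinv => ?_
  obtain ⟨y, hy⟩ := Multiset.exists_mem_of_ne_zero hmin.prop.2
  exact inv_ne_self_of_odd_card hodd (fun h => hY.one_notMem (h ▸ hy)) (hinv y)

theorem two_davenport_mem_systemOfLengths_iff_of_odd_card (h3 : 3 ≤ Nat.card G)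
    (hodd : Odd (Nat.card G)) : {2, davenport G} ∈ systemOfLengths G ↔
      Nonempty (G ≃* Multiplicative (ZMod (davenport G))) := by
  constructor
  · intro h
    obtain ⟨hc, hcard⟩ := isCyclic_and_card_eq_of_odd_card h3 hodd h
    rw [← hcard]
    exact ⟨(zmodCyclicMulEquiv hc).symm⟩
  · rintro ⟨e⟩
    have : IsCyclic G := e.isCyclic.2 inferInstance
    exact two_davenport_mem_systemOfLengths_of_isCyclic (by omega)

theorem nonempty_mulEquiv_of_systemOfLengths_eq {H : Type*} [Group H] [Finite H] [IsCyclic H]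
    (h3 : 3 ≤ Nat.card G) (hodd : Odd (Nat.card G))
    (h : systemOfLengths H = systemOfLengths G) : Nonempty (H ≃* G) := by
  have hD3 := three_le_davenport_of_odd_card h3 hodd
  have hD := davenport_eq_of_systemOfLengths_eq h.symm hD3
  have hDH := davenport_eq_card_of_isCyclic H
  have hmem : {2, davenport G} ∈ systemOfLengths G := by
    rw [hD, ← h]
    exact two_davenport_mem_systemOfLengths_of_isCyclic (by omega)
  obtain ⟨hc, hcard⟩ := isCyclic_and_card_eq_of_odd_card h3 hodd hmem
  exact ⟨mulEquivOfCyclicCardEq (by omega)⟩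

end CyclicAndOdd

section Even

variable {G : Type*} [Group G] {x y : G} {i j : ℕ}

theorem replicate_add_replicate_mem_productOne_of_even (hx : x ^ 2 = 1) (hy : y ^ 2 = 1)
    (hi : Even i) (hj : Even j) :
    Multiset.replicate i x + Multiset.replicate j y ∈ productOne G := by
  obtain ⟨p, rfl⟩ := hi.two_dvd
  obtain ⟨q, rfl⟩ := hj.two_dvd
  exact add_mem (replicate_mem_productOne_iff.2 (by rw [pow_mul, hx, one_pow]))
    (replicate_mem_productOne_iff.2 (by rw [pow_mul, hy, one_pow]))

theorem IsProductOneAtom.card_eq_two_of_even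
    (hT : IsProductOneAtom (Multiset.replicate i x + Multiset.replicate j y))
    (hx : x ^ 2 = 1) (hy : y ^ 2 = 1) (hi : Even i) (hj : Even j) : i + j = 2 := by
  wlog hi0 : i ≠ 0 generalizing i j x y
  · have hj0 : j ≠ 0 := by
      rintro rfl
      exact hT.ne_zero (by simp [not_not.1 hi0])
    rw [add_comm] at hT ⊢
    exact this hT hy hx hj hi hj0
  obtain ⟨k, rfl⟩ : ∃ k, i = k + 2 :=
    Nat.exists_eq_add_of_le' (by obtain ⟨m, rfl⟩ := hi; omega)
  have hrest := replicate_add_replicate_mem_productOne_of_even hx hy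
    (show Even k by simpa [Nat.even_add] using hi) hj
  have h0 := (hT.eq_zero_or_eq_zero (replicate_mem_productOne_iff.2 hx) hrest
    (by rw [Multiset.replicate_add]; abel)).resolve_left (by simp)
  have := congrArg Multiset.card h0
  simp only [Multiset.card_add, Multiset.card_replicate, Multiset.card_zero] at this
  omega

end Even

section Dihedral

open DihedralGroup

variable {n : ℕ}

/-- The determinant of an element of the dihedral group, as a group of isometries of the plane. -/
def dihedralDet (n : ℕ) : DihedralGroup n →* ℤˣ where
  toFun
    | r _ => 1
    | sr _ => -1
  map_one' := rfl
  map_mul' := by rintro (i | i) (j | j) <;> rfl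

/-- The element `x` is the rotation `r t` or the reflection `sr (c + t)` for an integer `t` of
absolute value at most `k` and of the same parity as `k`. Since integers represent residues
modulo `n`, this retains the parity of `t` even though `n` may be odd. -/
def IsShift (c : ZMod n) (k : ℕ) (x : DihedralGroup n) : Prop :=
  ∃ t : ℤ, |t| ≤ k ∧ Even (t + k) ∧ (x = r (t : ZMod n) ∨ x = sr (c + (t : ZMod n)))

theorem IsShift.mul {c : ZMod n} {k m : ℕ} {x y : DihedralGroup n} (hx : IsShift c k x)
    (hy : IsShift c m y) : IsShift c (k + m) (x * y) := by
  obtain ⟨s, hs, hsk, hx⟩ := hx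
  obtain ⟨t, ht, htm, hy⟩ := hy
  have habs_add : |t + s| ≤ (k + m : ℕ) := by push_cast; linarith [abs_add_le t s]
  have habs_sub : |t - s| ≤ (k + m : ℕ) := by push_cast; linarith [abs_sub t s]
  have heven_add : Even (t + s + (k + m : ℕ)) := by push_cast; grind
  have heven_sub : Even (t - s + (k + m : ℕ)) := by push_cast; grind
  rcases hx with rfl | rfl <;> rcases hy with rfl | rfl
  · exact ⟨t + s, habs_add, heven_add, Or.inl (by rw [r_mul_r]; push_cast; ring_nf)⟩
  · exact ⟨t - s, habs_sub, heven_sub, Or.inr (by rw [r_mul_sr]; push_cast; ring_nf)⟩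
  · exact ⟨t + s, habs_add, heven_add, Or.inr (by rw [sr_mul_r]; push_cast; ring_nf)⟩
  · exact ⟨t - s, habs_sub, heven_sub, Or.inl (by rw [sr_mul_sr]; push_cast; ring_nf)⟩

theorem IsShift.list_prod [DecidableEq (DihedralGroup n)] {c : ZMod n} {x y : DihedralGroup n}
    (hx : IsShift c 1 x) (hy : IsShift c 0 y) {l : List (DihedralGroup n)}
    (hl : ∀ z ∈ l, z = x ∨ z = y) : IsShift c (l.count x) l.prod := by
  induction l with
  | nil => exact ⟨0, by simp⟩
  | cons z l ih =>
    have hl' := ih fun w hw => hl w (List.mem_cons_of_mem z hw)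
    by_cases hz : z = x
    · rw [hz, List.count_cons_self, List.prod_cons, add_comm]
      exact hx.mul hl'
    · rw [List.count_cons_of_ne hz, List.prod_cons, (hl z List.mem_cons_self).resolve_left hz,
        ← zero_add (l.count x)]
      exact hy.mul hl'

theorem IsShift.le_of_odd {c : ZMod n} {k : ℕ} (h : IsShift c k 1) (hk : Odd k) : n ≤ k := by
  obtain ⟨t, ht, htk, hr | hsr⟩ := h
  · rw [one_def, r.injEq, eq_comm, ZMod.intCast_zmod_eq_zero_iff_dvd] at hr
    have ht0 : t ≠ 0 := by
      rintro rfl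
      rw [zero_add, Int.even_coe_nat] at htk
      exact Nat.not_even_iff_odd.2 hk htk
    have := Int.le_of_dvd (abs_pos.2 ht0) ((dvd_abs _ _).2 hr)
    omega
  · cases hsr

theorem le_of_replicate_add_replicate_mem_productOne {c : ZMod n} {x y : DihedralGroup n}
    (hx : IsShift c 1 x) (hy : IsShift c 0 y) (hne : x ≠ y) {a b : ℕ}
    (h : Multiset.replicate a x + Multiset.replicate b y ∈ productOne (DihedralGroup n))
    (ha : Odd a) : n ≤ a := by
  classical
  obtain ⟨l, hl, hprod⟩ := h
  have hcount : l.count x = a := by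
    rw [← Multiset.coe_count, hl, Multiset.count_add, Multiset.count_replicate_self,
      Multiset.count_replicate, if_neg hne.symm, add_zero]
  have hshift := hx.list_prod hy (l := l) fun z hz => by
    rw [← Multiset.mem_coe, hl, Multiset.mem_add] at hz
    exact hz.imp Multiset.eq_of_mem_replicate Multiset.eq_of_mem_replicate
  rw [hcount, hprod] at hshift
  exact hshift.le_of_odd ha

theorem isShift_zero_sr (c : ZMod n) : IsShift c 0 (sr c) := ⟨0, by simp⟩

theorem isShift_one_r_one (c : ZMod n) : IsShift c 1 (r 1) := ⟨1, by simp⟩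

theorem sr_zero_ne_sr_one (hn : 2 ≤ n) : (sr 0 : DihedralGroup n) ≠ sr 1 := by
  have : Fact (1 < n) := ⟨hn⟩
  simp

theorem even_add_of_replicate_sr_mem_productOne {c d : ZMod n} {a b : ℕ}
    (h : Multiset.replicate a (sr c) + Multiset.replicate b (sr d) ∈
      productOne (DihedralGroup n)) : Even (a + b) := by
  have hdet := prod_map_eq_one_of_mem_productOne (dihedralDet n) h
  rw [Multiset.map_add, Multiset.map_replicate, Multiset.map_replicate, Multiset.prod_add,
    Multiset.prod_replicate, Multiset.prod_replicate] at hdet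
  change (-1) ^ a * (-1) ^ b = (1 : ℤˣ) at hdet
  rw [← pow_add] at hdet
  by_contra hodd
  rw [(Nat.not_even_iff_odd.1 hodd).neg_one_pow] at hdet
  exact absurd hdet (by decide)

theorem even_of_replicate_r_add_replicate_sr_mem_productOne {c d : ZMod n} {a b : ℕ}
    (h : Multiset.replicate a (r c) + Multiset.replicate b (sr d) ∈
      productOne (DihedralGroup n)) : Even b := by
  have hdet := prod_map_eq_one_of_mem_productOne (dihedralDet n) h
  rw [Multiset.map_add, Multiset.map_replicate, Multiset.map_replicate, Multiset.prod_add,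
    Multiset.prod_replicate, Multiset.prod_replicate] at hdet
  change 1 ^ a * (-1) ^ b = (1 : ℤˣ) at hdet
  rw [one_pow, one_mul] at hdet
  by_contra hodd
  rw [(Nat.not_even_iff_odd.1 hodd).neg_one_pow] at hdet
  exact absurd hdet (by decide)

theorem le_and_le_of_replicate_sr_mem_productOne (hn : 2 ≤ n) {i j : ℕ}
    (h : Multiset.replicate i (sr 0) + Multiset.replicate j (sr 1) ∈
      productOne (DihedralGroup n)) (hi : Odd i) : n ≤ i ∧ n ≤ j := by
  have hj : Odd j := by
    have := even_add_of_replicate_sr_mem_productOne h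
    grind
  have hne := sr_zero_ne_sr_one hn
  have hshift_zero : IsShift (1 : ZMod n) 1 (sr 0) := ⟨-1, by simp⟩
  have hshift_one : IsShift (0 : ZMod n) 1 (sr 1) := ⟨1, by simp⟩
  refine ⟨le_of_replicate_add_replicate_mem_productOne hshift_zero (isShift_zero_sr 1) hne h hi, ?_⟩
  rw [add_comm] at h
  exact le_of_replicate_add_replicate_mem_productOne hshift_one (isShift_zero_sr 0) hne.symm h hj

theorem isProductOneAtom_replicate_sr (hn : 2 ≤ n) (hodd : Odd n) : IsProductOneAtom
    (Multiset.replicate n (sr 0 : DihedralGroup n) + Multiset.replicate n (sr 1)) where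
  mem_productOne := by
    rw [← Multiset.nsmul_singleton, ← Multiset.nsmul_singleton, ← nsmul_add]
    exact nsmul_coe_mem_productOne (l := [sr 0, sr 1]) (by simp)
  ne_zero h := by
    have := congrArg Multiset.card h
    simp only [Multiset.card_add, Multiset.card_replicate, Multiset.card_zero] at this
    omega
  eq_zero_or_eq_zero A hA B hB hAB := by
    obtain ⟨i, i', j, j', hi, hj, rfl, rfl⟩ := exists_eq_replicate_add_replicate_of_add_eq hAB
    rcases Nat.even_or_odd i with hi_even | hi_odd
    · have hi'_odd : Odd i' := by grind
      have := le_and_le_of_replicate_sr_mem_productOne hn hB hi'_odd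
      left
      rw [show i = 0 by omega, show j = 0 by omega]
      rfl
    · have := le_and_le_of_replicate_sr_mem_productOne hn hA hi_odd
      right
      rw [show i' = 0 by omega, show j' = 0 by omega]
      rfl

theorem IsProductOneAtom.card_eq_two_or_eq_of_replicate_sr (hn : 2 ≤ n) (hodd : Odd n) {i j : ℕ}
    (hT : IsProductOneAtom
      (Multiset.replicate i (sr 0 : DihedralGroup n) + Multiset.replicate j (sr 1))) :
    i + j = 2 ∨ i = n ∧ j = n := by
  have hsq_zero : (sr 0 : DihedralGroup n) ^ 2 = 1 := by rw [sq, sr_mul_self]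
  have hsq_one : (sr 1 : DihedralGroup n) ^ 2 = 1 := by rw [sq, sr_mul_self]
  have hij := even_add_of_replicate_sr_mem_productOne hT.mem_productOne
  rcases Nat.even_or_odd i with hi | hi
  · exact Or.inl (hT.card_eq_two_of_even hsq_zero hsq_one hi ((Nat.even_add.1 hij).1 hi))
  · obtain ⟨hni, hnj⟩ := le_and_le_of_replicate_sr_mem_productOne hn hT.mem_productOne hi
    obtain ⟨p, rfl⟩ := Nat.exists_eq_add_of_le hni
    obtain ⟨q, rfl⟩ := Nat.exists_eq_add_of_le hnj
    have hp : Even p := by grind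
    have hq : Even q := by grind
    have hrest := replicate_add_replicate_mem_productOne_of_even hsq_zero hsq_one hp hq
    have hU := isProductOneAtom_replicate_sr hn hodd
    have h0 := (hT.eq_zero_or_eq_zero hU.mem_productOne hrest
      (by rw [Multiset.replicate_add, Multiset.replicate_add, add_add_add_comm])).resolve_left
      hU.ne_zero
    have := congrArg Multiset.card h0
    simp only [Multiset.card_add, Multiset.card_replicate, Multiset.card_zero] at this
    omega

theorem davenport_dihedralGroup (hn : 2 ≤ n) (hodd : Odd n) :
    davenport (DihedralGroup n) = 2 * n := by
  have : NeZero n := ⟨by omega⟩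
  have hle : davenport (DihedralGroup n) ≤ 2 * n := nat_card (n := n) ▸ davenport_le_card
  refine hle.antisymm ?_
  have hge := (isProductOneAtom_replicate_sr hn hodd).card_le_davenport
  rwa [Multiset.card_add, Multiset.card_replicate, Multiset.card_replicate, ← two_mul] at hge

theorem two_davenport_mem_systemOfLengths_dihedralGroup (hn : 2 ≤ n) (hodd : Odd n) :
    {2, davenport (DihedralGroup n)} ∈ systemOfLengths (DihedralGroup n) := by
  have hU := isProductOneAtom_replicate_sr hn hodd
  have hUc : (Multiset.replicate n (sr 0 : DihedralGroup n) + Multiset.replicate n (sr 1)).card =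
      2 * n := by simp [two_mul]
  have hinv : (Multiset.replicate n (sr 0 : DihedralGroup n) + Multiset.replicate n (sr 1)).map
      (·⁻¹) = Multiset.replicate n (sr 0) + Multiset.replicate n (sr 1) := by
    simp only [Multiset.map_add, Multiset.map_replicate, inv_sr]
  have hL := hU.lengths_add_map_inv_eq (hU.one_notMem (by omega)) fun T hTle hT => by
    rw [hinv, add_add_add_comm, ← Multiset.replicate_add, ← Multiset.replicate_add] at hTle
    obtain ⟨i, -, j, -, -, -, rfl, -⟩ :=
      exists_eq_replicate_add_replicate_of_add_eq (add_tsub_cancel_of_le hTle)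
    rcases hT.card_eq_two_or_eq_of_replicate_sr hn hodd with hij | ⟨rfl, rfl⟩
    · exact Or.inl (by simpa using hij)
    · exact Or.inr (Or.inl rfl)
  rw [davenport_dihedralGroup hn hodd, ← hUc, ← hL]
  exact lengths_mem_systemOfLengths (add_mem hU.mem_productOne hU.map_inv.mem_productOne)

theorem isProductOneAtom_replicate_r_add_replicate_sr (hn : 2 ≤ n) (hodd : Odd n) :
    IsProductOneAtom
      (Multiset.replicate (2 * (n - 1)) (r 1 : DihedralGroup n) + Multiset.replicate 2 (sr 0)) where
  mem_productOne := by
    have hl : (List.replicate (n - 1) (r 1 : DihedralGroup n) ++ [sr 0]).prod ^ 2 = 1 := by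
      rw [List.prod_append, List.prod_replicate, List.prod_singleton, r_one_pow, r_mul_sr, sq,
        sr_mul_self]
    rw [← Multiset.nsmul_singleton, ← Multiset.nsmul_singleton, mul_nsmul', ← nsmul_add,
      Multiset.nsmul_singleton]
    exact nsmul_coe_mem_productOne hl
  ne_zero h := by simpa using congrArg Multiset.card h
  eq_zero_or_eq_zero A hA B hB hAB := by
    obtain ⟨i, i', j, j', hi, hj, rfl, rfl⟩ := exists_eq_replicate_add_replicate_of_add_eq hAB
    wlog hj0 : j = 0 generalizing i i' j j'
    · have hj_even := even_of_replicate_r_add_replicate_sr_mem_productOne hA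
      exact (this i' i j' j (by omega) (by omega) hB hA (by rw [add_comm, hAB]) (by grind)).symm
    subst hj0
    rw [Multiset.replicate_zero, add_zero] at hA ⊢
    rw [replicate_mem_productOne_iff, ← orderOf_dvd_iff_pow_eq_one, orderOf_r_one] at hA
    obtain ⟨m, rfl⟩ := hA
    have hm : m < 2 := by
      by_contra! hm
      have := Nat.mul_le_mul_left n hm
      omega
    interval_cases m
    · exact Or.inl rfl
    · have := le_of_replicate_add_replicate_mem_productOne (isShift_one_r_one 0) (isShift_zero_sr 0)
        (by simp) hB (by grind)
      omega

theorem exists_two_davenport_ssubset_mem_systemOfLengths_dihedralGroup (hn : 3 ≤ n)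
    (hodd : Odd n) : ∃ L ∈ systemOfLengths (DihedralGroup n),
      {2, davenport (DihedralGroup n)} ⊂ L := by
  have hW := isProductOneAtom_replicate_r_add_replicate_sr (by omega) hodd
  have hT : IsProductOneAtom (Multiset.replicate n (r 1 : DihedralGroup n)) := by
    have hfin : IsOfFinOrder (r 1 : DihedralGroup n) :=
      orderOf_pos_iff.1 (by rw [orderOf_r_one]; omega)
    simpa only [orderOf_r_one] using (isMinimalProductOne_replicate_orderOf hfin).isProductOneAtom
  set W : Multiset (DihedralGroup n) :=
    Multiset.replicate (2 * (n - 1)) (r 1) + Multiset.replicate 2 (sr 0) with hW_def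
  set R : Multiset (DihedralGroup n) :=
    Multiset.replicate (n - 2) (r 1) + Multiset.replicate 2 (sr 0) with hR_def
  have hWR : W = Multiset.replicate n (r 1) + R := by
    rw [hW_def, hR_def, ← add_assoc, ← Multiset.replicate_add]
    congr 2
    omega
  have hWc : W.card = davenport (DihedralGroup n) := by
    rw [davenport_dihedralGroup (by omega) hodd, hW_def, Multiset.card_add,
      Multiset.card_replicate, Multiset.card_replicate]
    omega
  have hRc : R.card = n := by
    rw [hR_def, Multiset.card_add, Multiset.card_replicate, Multiset.card_replicate]
    omega
  have h1 : (1 : DihedralGroup n) ∉ W := hW.one_notMem (by simp [hW_def])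
  refine ⟨_, lengths_mem_systemOfLengths (add_mem hW.mem_productOne hW.map_inv.mem_productOne),
    ssubset_of_subset_of_ne (hWc ▸ hW.two_card_subset_lengths h1) fun heq => ?_⟩
  have hmem : 2 + n ∈ lengths (W + W.map (·⁻¹)) := by
    have := two_add_card_mem_lengths hT fun h => h1 (hWR ▸ Multiset.mem_add.2 (Or.inr h))
    rwa [hRc, ← hWR] at this
  rw [← heq, davenport_dihedralGroup (by omega) hodd] at hmem
  rw [Set.mem_insert_iff, Set.mem_singleton_iff] at hmem
  omega

end Dihedral

theorem theorem4p4 {G Gs : Type*} [Group G] [Finite G] [Group Gs] [Finite Gs]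
    (n : ℕ) (hn : 3 ≤ n) (hodd : Odd n) :
    (3 ≤ Nat.card G → Odd (Nat.card G) →
      ({2, davenport G} ∈ systemOfLengths G ↔
        Nonempty (G ≃* Multiplicative (ZMod (davenport G))))) ∧
    (3 ≤ Nat.card G → Odd (Nat.card G) → IsCyclic Gs →
      systemOfLengths Gs = systemOfLengths G → Nonempty (Gs ≃* G)) ∧
    ({2, davenport (DihedralGroup n)} ∈ systemOfLengths (DihedralGroup n) ∧
      ∃ L ∈ systemOfLengths (DihedralGroup n), {2, davenport (DihedralGroup n)} ⊂ L) ∧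
    ((∀ x y : Gs, x * y = y * x) →
      systemOfLengths Gs ≠ systemOfLengths (DihedralGroup n)) := by
  have : NeZero n := ⟨by omega⟩
  have hmem := two_davenport_mem_systemOfLengths_dihedralGroup (by omega) hodd
  have hsup := exists_two_davenport_ssubset_mem_systemOfLengths_dihedralGroup hn hodd
  refine ⟨two_davenport_mem_systemOfLengths_iff_of_odd_card,
    fun h3 hoddG _ => nonempty_mulEquiv_of_systemOfLengths_eq h3 hoddG, ⟨hmem, hsup⟩, ?_⟩
  intro hcomm h
  have hD : 3 ≤ davenport (DihedralGroup n) := by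
    have := davenport_dihedralGroup (by omega) hodd
    omega
  have hDeq := davenport_eq_of_systemOfLengths_eq h.symm hD
  rw [hDeq] at hmem hsup hD
  rw [← h] at hmem hsup
  obtain ⟨L, hL, hsub⟩ := hsup
  let _ : CommGroup Gs := { ‹Group Gs› with mul_comm := hcomm }
  exact hsub.ne (eq_two_davenport_of_subset_of_mem_systemOfLengths hD hmem hL hsub.subset).symm
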